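/- Let $M$ be a smooth manifold of dimension $n$ (without boundary) and let $g$ be a smooth pseudo-Riemannian metric on $M$, i.e. a smooth field of symmetric non-degenerate bilinear forms of arbitrary signature. Let $\nabla$ be its Levi-Civita connection, with Christoffel symbols $\Gamma^\rho_{\mu\nu}=\tfrac12 g^{\rho\sigma}(\partial_\mu g_{\sigma\nu}+\partial_\nu g_{\sigma\mu}-\partial_\sigma g_{\mu\nu})$, and let $R_{\rho\sigma\mu\nu}=g_{\rho\kappa}R^\kappa{}_{\sigma\mu\nu}$ be its Riemann tensor, with $$R^\rho{}_{\sigma\mu\nu}=\partial_\mu\Gamma^\rho_{\nu\sigma}-\partial_\nu\Gamma^\rho_{\mu\sigma}+\Gamma^\rho_{\mu\kappa}\Gamma^\kappa_{\nu\sigma}-\Gamma^\rho_{\nu\kappa}\Gamma^\kappa_{\mu\sigma}.$$ Here $\nabla_\mu\nabla_\nu\xi_\rho$ denotes the components of the second covariant derivative $\nabla\nabla\xi$ of the covector field $\xi_\rho=g_{\rho\sigma}\xi^\sigma$. Theorem (homothetic Killing vectors solve the geodesic deviation equation). Let $\xi$ be a homothetic Killing vector of $g$, i.e. a smooth vector field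 on $M$ such that $$\nabla_\mu\xi_\nu+\nabla_\nu\xi_\mu=\lambda\, g_{\mu\nu}$$ for some constant $\lambda\in\mathbb R$ (possibly zero). Let $\gamma:J\to M$, with $J\subseteq\mathbb R$ open (for instance an open interval), be an affinely parametrized geodesic, i.e. a $C^2$ curve whose tangent vector $p=\dot\gamma$ satisfies $p^\mu\nabla_\mu p^\nu=0$. Then at every point of $\gamma$, in every system of local coordinates, $$p^\mu p^\nu\nabla_\mu\nabla_\nu\xi_\rho=-R_{\rho\mu\sigma\nu}\,p^\mu p^\nu\xi^\sigma ,$$ and $\xi$ restricted to $\gamma$ is a Jacobi field: with $D/dt$ the covariant derivative along $\gamma$, $$\frac{D^2\xi_\rho}{dt^2}=-R_{\rho\mu\sigma\nu}\,p^\mu p^\nu\xi^\sigma .$$ -/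

import Mathlib

open scoped Manifold ContDiff

noncomputable section

/-! ### Tensor calculus in coordinates

`G : Rn n → Matrix (Fin n) (Fin n) ℝ` is the matrix `g_{μν}` of a metric in a system of coordinates,
as a function of the point. All functions are only used on the (open) range of the coordinates. -/

/-- The space `ℝⁿ` in which coordinates take their values. -/
abbrev Rn (n : ℕ) : Type := EuclideanSpace ℝ (Fin n)

namespace Coord

variable {n : ℕ}

/-- The partial derivative `∂_μ f` at `y`. -/
def pd (μ : Fin n) (f : Rn n → ℝ) (y : Rn n) : ℝ :=
  fderiv ℝ f y (EuclideanSpace.single μ 1)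

/-- The Christoffel symbols
`Γ^ρ_{μν} = (1/2) g^{ρσ} (∂_μ g_{σν} + ∂_ν g_{σμ} - ∂_σ g_{μν})`, where `g^{ρσ}` is the inverse
matrix of `g_{ρσ}`. -/
def Gam (G : Rn n → Matrix (Fin n) (Fin n) ℝ) (ρ μ ν : Fin n) (y : Rn n) : ℝ :=
  (1 / 2) * ∑ σ, (G y)⁻¹ ρ σ *
    (pd μ (fun z => G z σ ν) y + pd ν (fun z => G z σ μ) y - pd σ (fun z => G z μ ν) y)

/-- The covariant derivative `∇_μ α_ν = ∂_μ α_ν - Γ^σ_{μν} α_σ` of a covector field. -/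
def nabla (G : Rn n → Matrix (Fin n) (Fin n) ℝ) (α : Fin n → Rn n → ℝ)
    (μ ν : Fin n) (y : Rn n) : ℝ :=
  pd μ (α ν) y - ∑ σ, Gam G σ μ ν y * α σ y

/-- The covariant derivative
`∇_μ T_{νρ} = ∂_μ T_{νρ} - Γ^σ_{μν} T_{σρ} - Γ^σ_{μρ} T_{νσ}` of a tensor field of type `(0,2)`. -/
def nablaT (G : Rn n → Matrix (Fin n) (Fin n) ℝ) (T : Fin n → Fin n → Rn n → ℝ)
    (μ ν ρ : Fin n) (y : Rn n) : ℝ :=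
  pd μ (T ν ρ) y - ∑ σ, Gam G σ μ ν y * T σ ρ y - ∑ σ, Gam G σ μ ρ y * T ν σ y

/-- The second covariant derivative `∇_μ ∇_ν α_ρ` of a covector field: the components of the
covariant derivative of the tensor field `∇α`. -/
def nabla2 (G : Rn n → Matrix (Fin n) (Fin n) ℝ) (α : Fin n → Rn n → ℝ)
    (μ ν ρ : Fin n) (y : Rn n) : ℝ :=
  nablaT G (nabla G α) μ ν ρ y

/-- The Riemann tensor
`R^ρ_{σμν} = ∂_μ Γ^ρ_{νσ} - ∂_ν Γ^ρ_{μσ} + Γ^ρ_{μκ} Γ^κ_{νσ} - Γ^ρ_{νκ} Γ^κ_{μσ}`,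
that is, `[∇_μ, ∇_ν] V^ρ = R^ρ_{σμν} V^σ`. -/
def riemUp (G : Rn n → Matrix (Fin n) (Fin n) ℝ) (ρ σ μ ν : Fin n) (y : Rn n) : ℝ :=
  pd μ (Gam G ρ ν σ) y - pd ν (Gam G ρ μ σ) y
    + ∑ κ, (Gam G ρ μ κ y * Gam G κ ν σ y - Gam G ρ ν κ y * Gam G κ μ σ y)

/-- The Riemann tensor with all indices down, `R_{ρσμν} = g_{ρκ} R^κ_{σμν}`. -/
def riem (G : Rn n → Matrix (Fin n) (Fin n) ℝ) (ρ σ μ ν : Fin n) (y : Rn n) : ℝ :=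
  ∑ κ, G y ρ κ * riemUp G κ σ μ ν y

/-- The velocity `p^μ = dq^μ/dt` of a curve `q` in coordinate space. -/
def vel (q : ℝ → Rn n) (μ : Fin n) (t : ℝ) : ℝ :=
  deriv (fun s => q s μ) t

/-- The covariant derivative `DV^ν/dt = dV^ν/dt + Γ^ν_{μρ} p^μ V^ρ` along the curve `q` of a vector
field `V` along `q`. -/
def DVec (G : Rn n → Matrix (Fin n) (Fin n) ℝ) (q : ℝ → Rn n) (V : Fin n → ℝ → ℝ)
    (ν : Fin n) (t : ℝ) : ℝ :=
  deriv (V ν) t + ∑ μ, ∑ ρ, Gam G ν μ ρ (q t) * vel q μ t * V ρ t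

/-- The covariant derivative `Dα_ν/dt = dα_ν/dt - Γ^σ_{μν} p^μ α_σ` along the curve `q` of a
covector field `α` along `q`. -/
def DCov (G : Rn n → Matrix (Fin n) (Fin n) ℝ) (q : ℝ → Rn n) (α : Fin n → ℝ → ℝ)
    (ν : Fin n) (t : ℝ) : ℝ :=
  deriv (α ν) t - ∑ μ, ∑ σ, Gam G σ μ ν (q t) * vel q μ t * α σ t

end Coord

/-! ### Pseudo-Riemannian manifolds -/

section Manifold

variable {n : ℕ} {M : Type*} [TopologicalSpace M] [ChartedSpace (Rn n) M] [IsManifold (𝓡 n) ∞ M]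

/-- A smooth pseudo-Riemannian metric of arbitrary signature: a smooth field of symmetric
non-degenerate bilinear forms on the tangent spaces. -/
structure PseudoRiemannianMetric (n : ℕ) (M : Type*) [TopologicalSpace M] [ChartedSpace (Rn n) M]
    [IsManifold (𝓡 n) ∞ M] where
  /-- the bilinear form on the tangent space at `x` -/
  val (x : M) : TangentSpace (𝓡 n) x →L[ℝ] TangentSpace (𝓡 n) x →L[ℝ] ℝ
  symm (x : M) (v w : TangentSpace (𝓡 n) x) : val x v w = val x w v
  nondegenerate (x : M) (v : TangentSpace (𝓡 n) x) : (∀ w, val x v w = 0) → v = 0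
  contMDiff : ContMDiff (𝓡 n) ((𝓡 n).prod 𝓘(ℝ, Rn n →L[ℝ] Rn n →L[ℝ] ℝ)) ∞
    (fun x => Bundle.TotalSpace.mk' (Rn n →L[ℝ] Rn n →L[ℝ] ℝ)
      (E := fun x : M => TangentSpace (𝓡 n) x →L[ℝ] TangentSpace (𝓡 n) x →L[ℝ] ℝ) x (val x))

-- Makes the model space `ℝⁿ` a manifold through Mathlib's `chartedSpaceSelf`.
attribute [local instance 10000] chartedSpaceSelf

/-- `e` is a system of coordinates on `M`: a chart of the smooth structure. -/
def IsCoord (e : OpenPartialHomeomorph M (Rn n)) : Prop :=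
  e ∈ IsManifold.maximalAtlas (𝓡 n) ∞ M

/-- The coordinate vector field `∂_μ` of `e`, at the point with coordinates `y`. -/
def coordVec (e : OpenPartialHomeomorph M (Rn n)) (μ : Fin n) (y : Rn n) :
    TangentSpace (𝓡 n) (e.symm y) :=
  mfderiv 𝓘(ℝ, Rn n) (𝓡 n) e.symm y (EuclideanSpace.single μ (1 : ℝ) : Rn n)

/-- The components `g_{μν} = g(∂_μ, ∂_ν)` of the metric in the coordinates `e`. -/
def gMat (g : PseudoRiemannianMetric n M) (e : OpenPartialHomeomorph M (Rn n)) (y : Rn n) :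
    Matrix (Fin n) (Fin n) ℝ :=
  Matrix.of fun μ ν => g.val (e.symm y) (coordVec e μ y) (coordVec e ν y)

/-- The components `ξ^μ = dq^μ(ξ)` of a vector field in the coordinates `e`. -/
def vecUp (ξ : (x : M) → TangentSpace (𝓡 n) x) (e : OpenPartialHomeomorph M (Rn n))
    (μ : Fin n) (y : Rn n) : ℝ :=
  let v : Rn n := mfderiv (𝓡 n) 𝓘(ℝ, Rn n) e (e.symm y) (ξ (e.symm y))
  v μ

/-- The components `ξ_μ = g_{μν} ξ^ν` of the associated covector field. -/
def vecDown (g : PseudoRiemannianMetric n M) (ξ : (x : M) → TangentSpace (𝓡 n) x)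
    (e : OpenPartialHomeomorph M (Rn n)) (μ : Fin n) (y : Rn n) : ℝ :=
  ∑ ν, gMat g e y μ ν * vecUp ξ e ν y

/-- A homothetic Killing vector: a smooth vector field `ξ` with
`∇_μ ξ_ν + ∇_ν ξ_μ = lam g_{μν}` for some constant `lam` (possibly zero). -/
def IsHomotheticKilling (g : PseudoRiemannianMetric n M) (ξ : (x : M) → TangentSpace (𝓡 n) x) : Prop :=
  ContMDiff (𝓡 n) (𝓡 n).tangent ∞ (fun x => (⟨x, ξ x⟩ : TangentBundle (𝓡 n) M)) ∧
  ∃ lam : ℝ, ∀ e : OpenPartialHomeomorph M (Rn n), IsCoord e → ∀ y ∈ e.target, ∀ μ ν : Fin n,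
    Coord.nabla (gMat g e) (vecDown g ξ e) μ ν y + Coord.nabla (gMat g e) (vecDown g ξ e) ν μ y
      = lam * gMat g e y μ ν

/-- The curve `γ`, defined on the open set `J` of times, is an (affinely parametrized) geodesic:
it is twice continuously differentiable and its velocity satisfies
`p^μ ∇_μ p^ν = dp^ν/dt + Γ^ν_{μρ} p^μ p^ρ = 0`. -/
def IsGeodesicOn (g : PseudoRiemannianMetric n M) (γ : ℝ → M) (J : Set ℝ) : Prop :=
  ContMDiffOn 𝓘(ℝ, ℝ) (𝓡 n) 2 γ J ∧
  ∀ e : OpenPartialHomeomorph M (Rn n), IsCoord e → ∀ t ∈ J, γ t ∈ e.source → ∀ ν : Fin n,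
    Coord.DVec (gMat g e) (fun s => e (γ s)) (Coord.vel fun s => e (γ s)) ν t = 0

end Manifold

end

noncomputable section

namespace Coord

variable {n : ℕ}

/-! A homothetic Killing covector has second covariant derivatives that are algebraic in the
covector. Write `T_{μνρ} = ∇_μ∇_ν ξ_ρ`. Differentiating the Killing equation, with `λ` constant and
`∇g = 0`, makes `T` antisymmetric in its last two indices (`nabla2_antisymm`); the Ricci identity
expresses its antisymmetrization in the first two by curvature (`nabla2_comm`). As for the
Christoffel formula, these two facts determine `T`, and the first Bianchi identity simplifies the
answer to `T_{μνρ} = R^κ_{μνρ} ξ_κ` (`nabla2_eq`). The symmetries of the Riemann tensor and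
contraction with `p^μ p^ν` give the first claim.

Along a geodesic the term `(Dp/dt)^ν ∇_ν ξ_ρ` of `D²ξ_ρ/dt²` vanishes, so this second derivative is
`p^μ p^ν T_{μνρ}` (`DCov_DCov`), and the second claim follows. -/

lemma two_le_infty : (2 : WithTop ℕ∞) ≤ ∞ :=
  WithTop.coe_le_coe.2 (le_top : (2 : ℕ∞) ≤ ⊤)

/-! ### Calculus of partial derivatives. -/

section PartialDerivatives

variable {U : Set (Rn n)} {f g : Rn n → ℝ} {y : Rn n}

lemma differentiableAt_of_contDiffOn (hU : IsOpen U) (hf : ContDiffOn ℝ ∞ f U) (hy : y ∈ U) :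
    DifferentiableAt ℝ f y :=
  (hf.contDiffAt (hU.mem_nhds hy)).differentiableAt (by simp)

lemma pd_congr (hU : IsOpen U) (h : ∀ z ∈ U, f z = g z) (hy : y ∈ U) (μ : Fin n) :
    pd μ f y = pd μ g y := by
  have : f =ᶠ[nhds y] g := Filter.eventually_of_mem (hU.mem_nhds hy) h
  rw [pd, pd, this.fderiv_eq]

lemma pd_add (hf : DifferentiableAt ℝ f y) (hg : DifferentiableAt ℝ g y) (μ : Fin n) :
    pd μ (fun z => f z + g z) y = pd μ f y + pd μ g y := by
  simp [pd, fderiv_fun_add hf hg]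

lemma pd_sub (hf : DifferentiableAt ℝ f y) (hg : DifferentiableAt ℝ g y) (μ : Fin n) :
    pd μ (fun z => f z - g z) y = pd μ f y - pd μ g y := by
  simp [pd, fderiv_fun_sub hf hg]

lemma pd_mul (hf : DifferentiableAt ℝ f y) (hg : DifferentiableAt ℝ g y) (μ : Fin n) :
    pd μ (fun z => f z * g z) y = pd μ f y * g y + f y * pd μ g y := by
  simp [pd, fderiv_fun_mul hf hg]; ring

lemma pd_const_mul (hf : DifferentiableAt ℝ f y) (c : ℝ) (μ : Fin n) :
    pd μ (fun z => c * f z) y = c * pd μ f y := by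
  simp [pd, fderiv_const_mul hf]

lemma pd_sum {ι : Type*} (s : Finset ι) {F : ι → Rn n → ℝ}
    (hF : ∀ i ∈ s, DifferentiableAt ℝ (F i) y) (μ : Fin n) :
    pd μ (fun z => ∑ i ∈ s, F i z) y = ∑ i ∈ s, pd μ (F i) y := by
  simp [pd, fderiv_fun_sum hF]

lemma contDiffOn_pd (hU : IsOpen U) (hf : ContDiffOn ℝ ∞ f U) (μ : Fin n) :
    ContDiffOn ℝ ∞ (pd μ f) U :=
  (hf.fderiv_of_isOpen hU (by simp)).clm_apply contDiffOn_const

lemma pd_comm (hU : IsOpen U) (hf : ContDiffOn ℝ ∞ f U) (hy : y ∈ U) (μ ν : Fin n) :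
    pd μ (pd ν f) y = pd ν (pd μ f) y := by
  have hfy := hf.contDiffAt (hU.mem_nhds hy)
  have hd : DifferentiableAt ℝ (fderiv ℝ f) y :=
    ((hf.fderiv_of_isOpen hU (m := ∞) (by simp)).contDiffAt
      (hU.mem_nhds hy)).differentiableAt (by simp)
  have key : ∀ a b : Fin n, pd a (pd b f) y =
      fderiv ℝ (fderiv ℝ f) y (EuclideanSpace.single a 1) (EuclideanSpace.single b 1) := by
    intro a b
    change fderiv ℝ (fun z => fderiv ℝ f z (EuclideanSpace.single b 1)) y _ = _
    rw [fderiv_clm_apply hd (differentiableAt_const _)]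
    simp
  rw [key, key]
  exact (hfy.isSymmSndFDerivAt (by simpa using two_le_infty)) _ _

end PartialDerivatives

/-! ### Levi-Civita connection, curvature symmetries and the Killing identity in coordinates. -/

section Metric

/-- `G` is a smooth field of invertible symmetric matrices on `U`. -/
structure IsMetricOn (G : Rn n → Matrix (Fin n) (Fin n) ℝ) (U : Set (Rn n)) : Prop where
  isOpen : IsOpen U
  contDiffOn (i j : Fin n) : ContDiffOn ℝ ∞ (fun z => G z i j) U
  symm {z : Rn n} (hz : z ∈ U) (i j : Fin n) : G z i j = G z j i
  isUnit_det {z : Rn n} (hz : z ∈ U) : IsUnit (G z).det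

lemma contDiffOn_det {U : Set (Rn n)} {A : Rn n → Matrix (Fin n) (Fin n) ℝ}
    (hA : ∀ i j, ContDiffOn ℝ ∞ (fun z => A z i j) U) :
    ContDiffOn ℝ ∞ (fun z => (A z).det) U := by
  simp only [Matrix.det_apply']
  exact ContDiffOn.sum fun σ _ => contDiffOn_const.mul (contDiffOn_prod fun i _ => hA _ _)

variable {G : Rn n → Matrix (Fin n) (Fin n) ℝ} {U : Set (Rn n)} {y : Rn n}

lemma IsMetricOn.contDiffOn_inv (hG : IsMetricOn G U) (i j : Fin n) :
    ContDiffOn ℝ ∞ (fun z => (G z)⁻¹ i j) U := by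
  have h : ∀ z ∈ U, (G z)⁻¹ i j = ((G z).det)⁻¹ * (G z).adjugate i j := by
    intro z hz
    simp [Matrix.inv_def]
  refine ContDiffOn.congr ?_ h
  refine ((contDiffOn_det hG.contDiffOn).inv fun z hz => (hG.isUnit_det hz).ne_zero).mul ?_
  -- Cramer's rule: each entry of the adjugate is the determinant of `G` with one row replaced by a
  -- constant one.
  simp only [Matrix.adjugate_apply]
  refine contDiffOn_det fun k l => ?_
  simp only [Matrix.updateRow_apply]
  split_ifs
  · exact contDiffOn_const
  · exact hG.contDiffOn k l

lemma IsMetricOn.contDiffOn_Gam (hG : IsMetricOn G U) (ρ μ ν : Fin n) :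
    ContDiffOn ℝ ∞ (Gam G ρ μ ν) U := by
  have hp : ∀ a b c, ContDiffOn ℝ ∞ (pd a (fun z => G z b c)) U :=
    fun a b c => contDiffOn_pd hG.isOpen (hG.contDiffOn b c) a
  exact contDiffOn_const.mul (ContDiffOn.sum fun σ _ =>
    (hG.contDiffOn_inv ρ σ).mul (((hp _ _ _).add (hp _ _ _)).sub (hp _ _ _)))

lemma IsMetricOn.pd_symm (hG : IsMetricOn G U) (hy : y ∈ U) (μ i j : Fin n) :
    pd μ (fun z => G z i j) y = pd μ (fun z => G z j i) y :=
  pd_congr hG.isOpen (fun _ hz => hG.symm hz i j) hy μ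

lemma IsMetricOn.Gam_symm (hG : IsMetricOn G U) (hy : y ∈ U) (ρ μ ν : Fin n) :
    Gam G ρ μ ν y = Gam G ρ ν μ y := by
  unfold Gam
  congr 1
  refine Finset.sum_congr rfl fun σ _ => ?_
  rw [hG.pd_symm hy σ μ ν]
  ring

/-- The Christoffel symbols with the first index lowered. -/
lemma IsMetricOn.sum_mul_Gam (hG : IsMetricOn G U) (hy : y ∈ U) (ρ μ ν : Fin n) :
    ∑ κ, G y ρ κ * Gam G κ μ ν y = (1 / 2) *
      (pd μ (fun z => G z ρ ν) y + pd ν (fun z => G z ρ μ) y - pd ρ (fun z => G z μ ν) y) := by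
  let v : Fin n → ℝ := fun σ => (1 / 2) *
    (pd μ (fun z => G z σ ν) y + pd ν (fun z => G z σ μ) y - pd σ (fun z => G z μ ν) y)
  have h : ∀ κ, Gam G κ μ ν y = ((G y)⁻¹.mulVec v) κ := by
    intro κ
    simp only [Gam, Matrix.mulVec, dotProduct, v, Finset.mul_sum]
    exact Finset.sum_congr rfl fun σ _ => by ring
  have h2 : (G y).mulVec ((G y)⁻¹.mulVec v) = v := by
    rw [Matrix.mulVec_mulVec, Matrix.mul_nonsing_inv _ (hG.isUnit_det hy), Matrix.one_mulVec]
  simp only [h]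
  exact congrFun h2 ρ

/-- Metric compatibility of the Levi-Civita connection. -/
lemma IsMetricOn.pd_metric (hG : IsMetricOn G U) (hy : y ∈ U) (μ ρ σ : Fin n) :
    pd μ (fun z => G z ρ σ) y =
      ∑ κ, (G y ρ κ * Gam G κ μ σ y + Gam G κ μ ρ y * G y κ σ) := by
  have h1 := hG.sum_mul_Gam hy ρ μ σ
  have h2 := hG.sum_mul_Gam hy σ μ ρ
  have h3 : ∑ κ, Gam G κ μ ρ y * G y κ σ = ∑ κ, G y σ κ * Gam G κ μ ρ y :=
    Finset.sum_congr rfl fun κ _ => by rw [hG.symm hy κ σ, mul_comm]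
  rw [Finset.sum_add_distrib, h3, h1, h2, hG.pd_symm hy μ σ ρ, hG.pd_symm hy ρ μ σ,
    hG.pd_symm hy σ μ ρ]
  ring

/-- Absence of torsion: once the lower indices of `Γ` are symmetric, the cyclic sum cancels term by
term. -/
lemma IsMetricOn.riemUp_bianchi (hG : IsMetricOn G U) (hy : y ∈ U) (κ μ ν ρ : Fin n) :
    riemUp G κ μ ν ρ y + riemUp G κ ν ρ μ y + riemUp G κ ρ μ ν y = 0 := by
  have hs : ∀ a b c d, pd d (Gam G a b c) y = pd d (Gam G a c b) y :=
    fun a b c d => pd_congr hG.isOpen (fun _ hz => hG.Gam_symm hz a b c) hy d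
  simp only [riemUp, Finset.sum_sub_distrib]
  simp only [hG.Gam_symm hy _ ρ ν, hG.Gam_symm hy _ ρ μ, hG.Gam_symm hy _ ν μ,
    hs κ ρ ν, hs κ ρ μ, hs κ ν μ]
  ring

lemma riemUp_antisymm (κ σ μ ν : Fin n) : riemUp G κ σ μ ν y = -riemUp G κ σ ν μ y := by
  simp only [riemUp, Finset.sum_sub_distrib]
  ring

lemma riem_antisymm_right (ρ σ μ ν : Fin n) : riem G ρ σ μ ν y = -riem G ρ σ ν μ y := by
  simp only [riem, riemUp_antisymm _ σ μ ν, mul_neg, Finset.sum_neg_distrib]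

lemma IsMetricOn.riem_bianchi (hG : IsMetricOn G U) (hy : y ∈ U) (σ μ ν ρ : Fin n) :
    riem G σ μ ν ρ y + riem G σ ν ρ μ y + riem G σ ρ μ ν y = 0 := by
  simp only [riem, ← Finset.sum_add_distrib, ← mul_add, hG.riemUp_bianchi hy, mul_zero,
    Finset.sum_const_zero]

/-- Second partial derivatives of the metric commute. In matrix form `∂_a G = G Γ_a + Γ_aᵀ G`, and
equating `∂_μ∂_ν G` with `∂_ν∂_μ G` yields `G R + Rᵀ G = 0` for the curvature matrix `R`. -/
lemma IsMetricOn.riem_antisymm_left (hG : IsMetricOn G U) (hy : y ∈ U) (ρ σ μ ν : Fin n) :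
    riem G ρ σ μ ν y = -riem G σ ρ μ ν y := by
  let Γ : Fin n → Rn n → Matrix (Fin n) (Fin n) ℝ := fun a z => Matrix.of fun i j => Gam G i a j z
  let dΓ : Fin n → Fin n → Matrix (Fin n) (Fin n) ℝ :=
    fun a b => Matrix.of fun i j => pd a (Gam G i b j) y
  let dG : Fin n → Matrix (Fin n) (Fin n) ℝ := fun a => Matrix.of fun i j => pd a (fun z => G z i j) y
  let R : Matrix (Fin n) (Fin n) ℝ := Matrix.of fun i j => riemUp G i j μ ν y
  have hGd : ∀ i j, DifferentiableAt ℝ (fun z => G z i j) y :=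
    fun i j => differentiableAt_of_contDiffOn hG.isOpen (hG.contDiffOn i j) hy
  have hΓd : ∀ i j k, DifferentiableAt ℝ (Gam G i j k) y :=
    fun i j k => differentiableAt_of_contDiffOn hG.isOpen (hG.contDiffOn_Gam i j k) hy
  have hR : R = dΓ μ ν - dΓ ν μ + Γ μ y * Γ ν y - Γ ν y * Γ μ y := by
    ext i j
    simp [R, dΓ, Γ, riemUp, Matrix.mul_apply]
    ring
  have hdG : ∀ a, dG a = G y * Γ a y + (Γ a y).transpose * G y := by
    intro a
    ext i j
    simp [dG, Γ, Matrix.mul_apply, hG.pd_metric hy, Finset.sum_add_distrib]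
  have hddG : ∀ a b i j, pd a (pd b (fun z => G z i j)) y =
      (dG a * Γ b y + G y * dΓ a b + (dΓ a b).transpose * G y + (Γ b y).transpose * dG a) i j := by
    intro a b i j
    rw [pd_congr hG.isOpen (fun z hz => hG.pd_metric hz b i j) hy,
      pd_sum _ fun k _ => ((hGd i k).fun_mul (hΓd k b j)).fun_add ((hΓd k b i).fun_mul (hGd k j))]
    have : ∀ k, pd a (fun z => G z i k * Gam G k b j z + Gam G k b i z * G z k j) y =
        pd a (fun z => G z i k) y * Gam G k b j y + G y i k * pd a (Gam G k b j) y +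
        (pd a (Gam G k b i) y * G y k j + Gam G k b i y * pd a (fun z => G z k j) y) := by
      intro k
      rw [pd_add ((hGd i k).fun_mul (hΓd k b j)) ((hΓd k b i).fun_mul (hGd k j)),
        pd_mul (hGd i k) (hΓd k b j), pd_mul (hΓd k b i) (hGd k j)]
    simp only [this, Finset.sum_add_distrib]
    simp [dG, Γ, dΓ, Matrix.mul_apply, Matrix.add_apply, add_assoc]
  have hcomm : dG μ * Γ ν y + G y * dΓ μ ν + (dΓ μ ν).transpose * G y + (Γ ν y).transpose * dG μ =
      dG ν * Γ μ y + G y * dΓ ν μ + (dΓ ν μ).transpose * G y + (Γ μ y).transpose * dG ν := by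
    ext i j
    rw [← hddG, ← hddG, pd_comm hG.isOpen (hG.contDiffOn i j) hy]
  have hfin : G y * R + R.transpose * G y = 0 := by
    -- The mixed terms `Γ_μᵀ G Γ_ν + Γ_νᵀ G Γ_μ` are symmetric in `μ, ν` and drop out of the
    -- difference.
    rw [hdG, hdG] at hcomm
    rw [hR]
    simp only [Matrix.transpose_add, Matrix.transpose_sub, Matrix.transpose_mul]
    rw [← sub_eq_zero] at hcomm
    rw [← hcomm]
    noncomm_ring
  have := congrFun (congrFun hfin ρ) σ
  have h2 : ∑ k, riemUp G k ρ μ ν y * G y k σ = riem G σ ρ μ ν y :=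
    Finset.sum_congr rfl fun k _ => by rw [hG.symm hy k σ, mul_comm]
  simp only [Matrix.add_apply, Matrix.mul_apply, Matrix.transpose_apply, R, Matrix.of_apply,
    Matrix.zero_apply, h2] at this
  change riem G ρ σ μ ν y + _ = 0 at this
  linarith

/-- The classical linear combination of four Bianchi identities, simplified by the two
antisymmetries. -/
lemma IsMetricOn.riem_pair_symm (hG : IsMetricOn G U) (hy : y ∈ U) (ρ σ μ ν : Fin n) :
    riem G ρ σ μ ν y = riem G μ ν ρ σ y := by
  have b := fun i j k l => hG.riem_bianchi hy i j k l
  have l := fun i j k l => hG.riem_antisymm_left hy i j k l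
  have r := fun i j k l => riem_antisymm_right (G := G) (y := y) i j k l
  linarith [b ρ σ μ ν, b σ ρ μ ν, b μ ν ρ σ, b ν μ ρ σ, l ρ σ μ ν, l μ ν ρ σ, r ρ σ μ ν, r μ ν ρ σ,
    l ρ μ ν σ, l ρ ν σ μ, l ρ ν μ σ, l σ μ ν ρ, l σ ν ρ μ, l σ μ ρ ν, l σ ν μ ρ, l ρ μ σ ν,
    r ρ μ ν σ, r ρ ν σ μ, r σ μ ν ρ, r σ ν ρ μ, r μ ρ σ ν, r μ σ ν ρ, r ν ρ σ μ, r ν σ μ ρ,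
    l μ ν σ ρ, l ρ σ ν μ]

lemma IsMetricOn.contDiffOn_nabla (hG : IsMetricOn G U) {α : Fin n → Rn n → ℝ}
    (hα : ∀ i, ContDiffOn ℝ ∞ (α i) U) (μ ν : Fin n) : ContDiffOn ℝ ∞ (nabla G α μ ν) U :=
  (contDiffOn_pd hG.isOpen (hα ν) μ).sub
    (ContDiffOn.sum fun σ _ => (hG.contDiffOn_Gam σ μ ν).mul (hα σ))

/-- The Ricci identity for covector fields. -/
lemma IsMetricOn.nabla2_comm (hG : IsMetricOn G U) (hy : y ∈ U) {α : Fin n → Rn n → ℝ}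
    (hα : ∀ i, ContDiffOn ℝ ∞ (α i) U) (μ ν ρ : Fin n) :
    nabla2 G α μ ν ρ y - nabla2 G α ν μ ρ y = -∑ κ, riemUp G κ ρ μ ν y * α κ y := by
  have hαd : ∀ i, DifferentiableAt ℝ (α i) y :=
    fun i => differentiableAt_of_contDiffOn hG.isOpen (hα i) hy
  have hpα : ∀ a i, DifferentiableAt ℝ (pd a (α i)) y :=
    fun a i => differentiableAt_of_contDiffOn hG.isOpen (contDiffOn_pd hG.isOpen (hα i) a) hy
  have hΓd : ∀ i j k, DifferentiableAt ℝ (Gam G i j k) y :=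
    fun i j k => differentiableAt_of_contDiffOn hG.isOpen (hG.contDiffOn_Gam i j k) hy
  have hpd : ∀ a b c, pd a (nabla G α b c) y = pd a (pd b (α c)) y -
      (∑ σ, pd a (Gam G σ b c) y * α σ y + ∑ σ, Gam G σ b c y * pd a (α σ) y) := by
    intro a b c
    change pd a (fun z => pd b (α c) z - ∑ σ, Gam G σ b c z * α σ z) y = _
    rw [pd_sub (hpα b c) (DifferentiableAt.fun_sum fun σ _ => (hΓd σ b c).fun_mul (hαd σ)),
      pd_sum _ fun σ _ => (hΓd σ b c).fun_mul (hαd σ), ← Finset.sum_add_distrib]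
    congr 1
    exact Finset.sum_congr rfl fun σ _ => pd_mul (hΓd σ b c) (hαd σ) a
  -- The `Γ ∂α` part cancels against that of `hpd` after antisymmetrization; the `ΓΓα` part becomes
  -- the quadratic part of the curvature.
  have hquad : ∀ a b, ∑ σ, Gam G σ a ρ y * nabla G α b σ y =
      ∑ σ, Gam G σ a ρ y * pd b (α σ) y -
        ∑ κ, (∑ σ, Gam G κ b σ y * Gam G σ a ρ y) * α κ y := by
    intro a b
    simp only [nabla, mul_sub, Finset.sum_sub_distrib, Finset.mul_sum, Finset.sum_mul]
    congr 1
    rw [Finset.sum_comm]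
    exact Finset.sum_congr rfl fun κ _ => Finset.sum_congr rfl fun σ _ => by ring
  have hfirst : ∑ σ, Gam G σ μ ν y * nabla G α σ ρ y = ∑ σ, Gam G σ ν μ y * nabla G α σ ρ y :=
    Finset.sum_congr rfl fun σ _ => by rw [hG.Gam_symm hy]
  have hR : ∑ κ, riemUp G κ ρ μ ν y * α κ y =
      ∑ σ, pd μ (Gam G σ ν ρ) y * α σ y - ∑ σ, pd ν (Gam G σ μ ρ) y * α σ y +
      (∑ κ, (∑ σ, Gam G κ μ σ y * Gam G σ ν ρ y) * α κ y -
        ∑ κ, (∑ σ, Gam G κ ν σ y * Gam G σ μ ρ y) * α κ y) := by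
    rw [← Finset.sum_sub_distrib, ← Finset.sum_sub_distrib, ← Finset.sum_add_distrib]
    refine Finset.sum_congr rfl fun κ _ => ?_
    rw [riemUp, Finset.sum_sub_distrib]
    ring
  simp only [nabla2, nablaT]
  rw [hpd, hpd, hquad, hquad, hfirst, hR, pd_comm hG.isOpen (hα ρ) hy]
  ring

lemma IsMetricOn.nablaT_metric (hG : IsMetricOn G U) (hy : y ∈ U) (μ ν ρ : Fin n) :
    nablaT G (fun a b z => G z a b) μ ν ρ y = 0 := by
  simp only [nablaT, hG.pd_metric hy, Finset.sum_add_distrib]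
  have : ∑ κ, Gam G κ μ ρ y * G y ν κ = ∑ κ, G y ν κ * Gam G κ μ ρ y :=
    Finset.sum_congr rfl fun κ _ => mul_comm _ _
  linarith

/-- The homothetic Killing equation on `U` for a covector field. -/
def IsHomotheticKillingOn (G : Rn n → Matrix (Fin n) (Fin n) ℝ) (U : Set (Rn n))
    (α : Fin n → Rn n → ℝ) (lam : ℝ) : Prop :=
  ∀ z ∈ U, ∀ μ ν : Fin n, nabla G α μ ν z + nabla G α ν μ z = lam * G z μ ν

/-- The covariant derivative of the Killing equation is `∇_μ(∇_ν α_ρ + ∇_ρ α_ν) = λ ∇_μ g_{νρ} = 0`.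
-/
lemma IsMetricOn.nabla2_antisymm (hG : IsMetricOn G U) (hy : y ∈ U) {α : Fin n → Rn n → ℝ}
    (hα : ∀ i, ContDiffOn ℝ ∞ (α i) U) {lam : ℝ} (hK : IsHomotheticKillingOn G U α lam)
    (μ ν ρ : Fin n) : nabla2 G α μ ν ρ y = -nabla2 G α μ ρ ν y := by
  have hnd : ∀ a b, DifferentiableAt ℝ (nabla G α a b) y :=
    fun a b => differentiableAt_of_contDiffOn hG.isOpen (hG.contDiffOn_nabla hα a b) hy
  have hGd : DifferentiableAt ℝ (fun z => G z ν ρ) y :=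
    differentiableAt_of_contDiffOn hG.isOpen (hG.contDiffOn ν ρ) hy
  have h1 : pd μ (nabla G α ν ρ) y + pd μ (nabla G α ρ ν) y = lam * pd μ (fun z => G z ν ρ) y := by
    rw [← pd_add (hnd _ _) (hnd _ _), ← pd_const_mul hGd]
    exact pd_congr hG.isOpen (fun z hz => hK z hz ν ρ) hy μ
  have h2 : ∀ a b, ∑ σ, Gam G σ μ a y * nabla G α σ b y + ∑ σ, Gam G σ μ a y * nabla G α b σ y =
      lam * ∑ σ, Gam G σ μ a y * G y σ b := by
    intro a b
    rw [← Finset.sum_add_distrib, Finset.mul_sum]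
    refine Finset.sum_congr rfl fun σ _ => ?_
    rw [← mul_add, hK y hy σ b]
    ring
  have h3 := hG.nablaT_metric hy μ ν ρ
  have h4 : ∑ σ, Gam G σ μ ρ y * G y ν σ = ∑ σ, Gam G σ μ ρ y * G y σ ν :=
    Finset.sum_congr rfl fun σ _ => by rw [hG.symm hy]
  simp only [nablaT, h4] at h3
  simp only [nabla2, nablaT]
  linear_combination h1 - h2 ν ρ - h2 ρ ν + lam * h3

/-- The second covariant derivative of a homothetic Killing covector is algebraic in the covector:
`∇_μ ∇_ν α_ρ = R^κ_{μνρ} α_κ`. -/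
lemma IsMetricOn.nabla2_eq (hG : IsMetricOn G U) (hy : y ∈ U) {α : Fin n → Rn n → ℝ}
    (hα : ∀ i, ContDiffOn ℝ ∞ (α i) U) {lam : ℝ} (hK : IsHomotheticKillingOn G U α lam)
    (μ ν ρ : Fin n) : nabla2 G α μ ν ρ y = ∑ κ, riemUp G κ μ ν ρ y * α κ y := by
  have hb : ∑ κ, riemUp G κ μ ν ρ y * α κ y + ∑ κ, riemUp G κ ν ρ μ y * α κ y +
      ∑ κ, riemUp G κ ρ μ ν y * α κ y = 0 := by
    simp only [← Finset.sum_add_distrib, ← add_mul, hG.riemUp_bianchi hy, zero_mul,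
      Finset.sum_const_zero]
  -- With `a, b, c` the three cyclic permutations of `∇_μ∇_ν α_ρ`, antisymmetry turns the Ricci
  -- identities into values for `a + b`, `b + c`, `c + a`; then `2a = (a + b) + (c + a) - (b + c)`,
  -- and `hb` reduces this to one curvature term.
  linarith [hG.nabla2_comm hy hα μ ν ρ, hG.nabla2_comm hy hα ν ρ μ, hG.nabla2_comm hy hα ρ μ ν,
    hG.nabla2_antisymm hy hα hK μ ν ρ, hG.nabla2_antisymm hy hα hK ν ρ μ,
    hG.nabla2_antisymm hy hα hK ρ μ ν]

/-- The geodesic deviation equation for a homothetic Killing vector with components `v^σ`. -/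
lemma IsMetricOn.sum_nabla2 (hG : IsMetricOn G U) (hy : y ∈ U) {v : Fin n → Rn n → ℝ}
    (hv : ∀ i, ContDiffOn ℝ ∞ (v i) U) {lam : ℝ}
    (hK : IsHomotheticKillingOn G U (fun i z => ∑ j, G z i j * v j z) lam)
    (p : Fin n → ℝ) (ρ : Fin n) :
    ∑ μ, ∑ ν, p μ * p ν * nabla2 G (fun i z => ∑ j, G z i j * v j z) μ ν ρ y =
      -∑ μ, ∑ σ, ∑ ν, riem G ρ μ σ ν y * p μ * p ν * v σ y := by
  have hα : ∀ i, ContDiffOn ℝ ∞ (fun z => ∑ j, G z i j * v j z) U :=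
    fun i => ContDiffOn.sum fun j _ => (hG.contDiffOn i j).mul (hv j)
  have h : ∀ μ ν, nabla2 G (fun i z => ∑ j, G z i j * v j z) μ ν ρ y =
      -∑ σ, riem G ρ ν σ μ y * v σ y := by
    intro μ ν
    rw [hG.nabla2_eq hy hα hK, ← Finset.sum_neg_distrib]
    simp only [Finset.mul_sum]
    rw [Finset.sum_comm]
    refine Finset.sum_congr rfl fun σ _ => ?_
    -- `-R_{ρνσμ} = R_{νρσμ} = R_{σμνρ}`.
    rw [← neg_mul, ← hG.riem_antisymm_left hy, ← hG.riem_pair_symm hy, riem, Finset.sum_mul]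
    exact Finset.sum_congr rfl fun κ _ => by rw [hG.symm hy κ σ]; ring
  simp only [h]
  -- `h` has `μ` and `ν` in exchanged places; `p^μ p^ν` is symmetric, so the two sums may be
  -- swapped.
  rw [Finset.sum_comm, ← Finset.sum_neg_distrib]
  refine Finset.sum_congr rfl fun μ _ => ?_
  rw [Finset.sum_comm, ← Finset.sum_neg_distrib]
  refine Finset.sum_congr rfl fun ν _ => ?_
  rw [mul_neg, Finset.mul_sum]
  exact congrArg _ (Finset.sum_congr rfl fun σ _ => by ring)

end Metric

/-! ### Covariant derivatives along curves. -/

section Curve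

variable {G : Rn n → Matrix (Fin n) (Fin n) ℝ} {U : Set (Rn n)} {q : ℝ → Rn n} {t : ℝ}

lemma hasDerivAt_comp {f : Rn n → ℝ} (hf : DifferentiableAt ℝ f (q t))
    (hq : DifferentiableAt ℝ q t) :
    HasDerivAt (fun s => f (q s)) (∑ μ, vel q μ t * pd μ f (q t)) t := by
  have h := hf.hasFDerivAt.comp_hasDerivAt t hq.hasDerivAt
  have hv : ∀ μ, vel q μ t = deriv q t μ := fun μ =>
    (((EuclideanSpace.proj (𝕜 := ℝ) μ).hasFDerivAt.comp_hasDerivAt t hq.hasDerivAt)).deriv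
  have hs : deriv q t = ∑ μ, vel q μ t • EuclideanSpace.single μ (1 : ℝ) := by
    ext i
    simp [hv, Pi.single_apply]
  have he : fderiv ℝ f (q t) (deriv q t) = ∑ μ, vel q μ t * pd μ f (q t) := by
    rw [hs]
    simp [pd]
  rw [← he]
  exact h

/-- Along a curve, `Dα_ν/dt = p^μ ∇_μ α_ν` for the restriction of a covector field `α`. -/
lemma DCov_comp {α : Fin n → Rn n → ℝ} (hα : ∀ i, DifferentiableAt ℝ (α i) (q t))
    (hq : DifferentiableAt ℝ q t) (ν : Fin n) :
    DCov G q (fun κ s => α κ (q s)) ν t = ∑ μ, vel q μ t * nabla G α μ ν (q t) := by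
  simp only [DCov, nabla]
  rw [(hasDerivAt_comp (hα ν) hq).deriv, ← Finset.sum_sub_distrib]
  refine Finset.sum_congr rfl fun μ _ => ?_
  rw [mul_sub, Finset.mul_sum]
  exact congrArg _ (Finset.sum_congr rfl fun σ _ => by ring)

/-- Along a geodesic, `D²α_ρ/dt² = p^μ p^ν ∇_μ ∇_ν α_ρ`. -/
lemma IsMetricOn.DCov_DCov (hG : IsMetricOn G U) {α : Fin n → Rn n → ℝ}
    (hα : ∀ i, ContDiffOn ℝ ∞ (α i) U) (hq : ContDiffAt ℝ 2 q t) (hqU : q t ∈ U)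
    (hgeo : ∀ ν, DVec G q (vel q) ν t = 0) (ρ : Fin n) :
    DCov G q (DCov G q fun κ s => α κ (q s)) ρ t =
      ∑ μ, ∑ ν, vel q μ t * vel q ν t * nabla2 G α μ ν ρ (q t) := by
  have hqd : ∀ᶠ s in nhds t, ContDiffAt ℝ 2 q s := hq.eventually (by simp)
  have hqU' : ∀ᶠ s in nhds t, q s ∈ U :=
    hq.continuousAt.eventually (hG.isOpen.mem_nhds hqU)
  -- Equality near `t` is needed, since this expression is differentiated again.
  have hD : ∀ ν, DCov G q (fun κ s => α κ (q s)) ν =ᶠ[nhds t]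
      fun s => ∑ μ, vel q μ s * nabla G α μ ν (q s) := by
    intro ν
    filter_upwards [hqd, hqU'] with s hs hsU
    exact DCov_comp (fun i => differentiableAt_of_contDiffOn hG.isOpen (hα i) hsU)
      (hs.differentiableAt (by simp)) ν
  have hvel : ∀ ν, DifferentiableAt ℝ (vel q ν) t := by
    intro ν
    have h1 : ContDiffAt ℝ 2 (fun s => q s ν) t :=
      (EuclideanSpace.proj (𝕜 := ℝ) ν).contDiff.contDiffAt.comp t hq
    exact (h1.derivWithin (m := 1) (by norm_num [one_add_one_eq_two])).differentiableAt (by simp)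
  have hder : ∀ ν, deriv (vel q ν) t = -∑ μ, ∑ κ, Gam G ν μ κ (q t) * vel q μ t * vel q κ t :=
    fun ν => eq_neg_of_add_eq_zero_left (hgeo ν)
  have hN : ∀ μ ν, DifferentiableAt ℝ (nabla G α μ ν) (q t) := fun μ ν =>
    differentiableAt_of_contDiffOn hG.isOpen (hG.contDiffOn_nabla hα μ ν) hqU
  have hderN : deriv (fun s => ∑ μ, vel q μ s * nabla G α μ ρ (q s)) t =
      ∑ ν, (deriv (vel q ν) t * nabla G α ν ρ (q t) +
        vel q ν t * ∑ μ, vel q μ t * pd μ (nabla G α ν ρ) (q t)) :=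
    (HasDerivAt.fun_sum fun ν _ => (hvel ν).hasDerivAt.mul
      (hasDerivAt_comp (hN ν ρ) (hq.differentiableAt (by simp)))).deriv
  -- The geodesic equation replaces `dp/dt` by `-Γpp`, which supplies the connection term of `∇∇α`
  -- for the index `ν`; `e3` supplies the one for `ρ`.
  have e1 : ∑ ν, deriv (vel q ν) t * nabla G α ν ρ (q t) =
      -∑ μ, ∑ ν, ∑ σ, vel q μ t * vel q ν t * (Gam G σ μ ν (q t) * nabla G α σ ρ (q t)) := by
    simp only [hder, neg_mul, Finset.sum_neg_distrib, Finset.sum_mul]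
    rw [Finset.sum_comm]
    congr 1
    refine Finset.sum_congr rfl fun μ _ => ?_
    rw [Finset.sum_comm]
    exact Finset.sum_congr rfl fun ν _ => Finset.sum_congr rfl fun σ _ => by ring
  have e2 : ∑ ν, vel q ν t * ∑ μ, vel q μ t * pd μ (nabla G α ν ρ) (q t) =
      ∑ μ, ∑ ν, vel q μ t * vel q ν t * pd μ (nabla G α ν ρ) (q t) := by
    simp only [Finset.mul_sum]
    rw [Finset.sum_comm]
    exact Finset.sum_congr rfl fun ν _ => Finset.sum_congr rfl fun σ _ => by ring
  have e3 : ∑ μ, ∑ σ, Gam G σ μ ρ (q t) * vel q μ t * (∑ ν, vel q ν t * nabla G α ν σ (q t)) =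
      ∑ μ, ∑ ν, ∑ σ, vel q μ t * vel q ν t * (Gam G σ μ ρ (q t) * nabla G α ν σ (q t)) := by
    refine Finset.sum_congr rfl fun μ _ => ?_
    rw [Finset.sum_comm]
    refine Finset.sum_congr rfl fun σ _ => ?_
    rw [Finset.mul_sum]
    exact Finset.sum_congr rfl fun ν _ => by ring
  have e4 : DCov G q (DCov G q fun κ s => α κ (q s)) ρ t =
      deriv (fun s => ∑ μ, vel q μ s * nabla G α μ ρ (q s)) t -
      ∑ μ, ∑ σ, Gam G σ μ ρ (q t) * vel q μ t * (∑ ν, vel q ν t * nabla G α ν σ (q t)) := by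
    rw [DCov, (hD ρ).deriv_eq]
    simp only [(hD _).eq_of_nhds]
  rw [e4, hderN, Finset.sum_add_distrib, e1, e2, e3]
  simp only [nabla2, nablaT, mul_sub, Finset.sum_sub_distrib, Finset.mul_sum]
  ring

end Curve

end Coord

/-! ### From the manifold to coordinates. -/

section Manifold

variable {n : ℕ} {M : Type*} [TopologicalSpace M] [ChartedSpace (Rn n) M] [IsManifold (𝓡 n) ∞ M]

attribute [local instance 10000] chartedSpaceSelf

variable {e : OpenPartialHomeomorph M (Rn n)}

lemma IsCoord.contMDiffOn (he : IsCoord e) : ContMDiffOn (𝓡 n) 𝓘(ℝ, Rn n) ∞ e e.source :=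
  contMDiffOn_of_mem_maximalAtlas he

lemma IsCoord.contMDiffOn_symm (he : IsCoord e) :
    ContMDiffOn 𝓘(ℝ, Rn n) (𝓡 n) ∞ e.symm e.target :=
  contMDiffOn_symm_of_mem_maximalAtlas he

lemma IsCoord.mdifferentiable (he : IsCoord e) : e.MDifferentiable (𝓡 n) 𝓘(ℝ, Rn n) :=
  ⟨he.contMDiffOn.mdifferentiableOn (by simp), he.contMDiffOn_symm.mdifferentiableOn (by simp)⟩

/-- The coordinate field is the image of a constant section under the tangent map of `e.symm`. -/
lemma IsCoord.contMDiffOn_coordVec (he : IsCoord e) (μ : Fin n) :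
    ContMDiffOn 𝓘(ℝ, Rn n) (𝓡 n).tangent ∞
      (fun y => (⟨e.symm y, coordVec e μ y⟩ : TangentBundle (𝓡 n) M)) e.target := by
  have h1 : ContMDiffOn 𝓘(ℝ, Rn n).tangent (𝓡 n).tangent ∞
      (tangentMapWithin 𝓘(ℝ, Rn n) (𝓡 n) e.symm e.target) _ :=
    he.contMDiffOn_symm.contMDiffOn_tangentMapWithin (by simp) e.open_target.uniqueMDiffOn
  have h2 : ContMDiff 𝓘(ℝ, Rn n) 𝓘(ℝ, Rn n).tangent ∞
      (fun y : Rn n => (⟨y, EuclideanSpace.single μ (1 : ℝ)⟩ : TangentBundle 𝓘(ℝ, Rn n) (Rn n))) :=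
    contMDiff_vectorSpace_iff_contDiff.2 contDiff_const
  refine (h1.comp h2.contMDiffOn fun y hy => hy).congr fun y hy => ?_
  simp only [Function.comp, tangentMapWithin, coordVec]
  rw [mfderivWithin_of_isOpen e.open_target hy]

lemma IsCoord.contDiffOn_gMat (he : IsCoord e) (g : PseudoRiemannianMetric n M) (μ ν : Fin n) :
    ContDiffOn ℝ ∞ (fun y => gMat g e y μ ν) e.target := by
  have h := ContMDiffOn.clm_bundle_apply₂ (F₁ := Rn n) (F₂ := Rn n) (F₃ := ℝ)
    (E₃ := Bundle.Trivial M ℝ)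
    (g.contMDiff.comp_contMDiffOn he.contMDiffOn_symm)
    (he.contMDiffOn_coordVec μ) (he.contMDiffOn_coordVec ν)
  intro y hy
  have := h y hy
  rw [Bundle.contMDiffWithinAt_totalSpace] at this
  exact this.2.contDiffWithinAt

lemma IsCoord.contDiffOn_vecUp (he : IsCoord e) {ξ : (x : M) → TangentSpace (𝓡 n) x}
    (hξ : ContMDiff (𝓡 n) (𝓡 n).tangent ∞ (fun x => (⟨x, ξ x⟩ : TangentBundle (𝓡 n) M)))
    (μ : Fin n) : ContDiffOn ℝ ∞ (vecUp ξ e μ) e.target := by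
  have h1 : ContMDiffOn (𝓡 n).tangent 𝓘(ℝ, Rn n).tangent ∞
      (tangentMapWithin (𝓡 n) 𝓘(ℝ, Rn n) e e.source) _ :=
    he.contMDiffOn.contMDiffOn_tangentMapWithin (by simp) e.open_source.uniqueMDiffOn
  have h2 := h1.comp (hξ.comp_contMDiffOn he.contMDiffOn_symm) fun y hy => e.map_target hy
  have h3 := (contMDiff_snd_tangentBundle_modelSpace (Rn n) 𝓘(ℝ, Rn n)).comp_contMDiffOn h2
  refine ((EuclideanSpace.proj (𝕜 := ℝ) μ).contDiff.comp_contDiffOn h3.contDiffOn).congr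
    fun y hy => ?_
  simp only [vecUp, Function.comp, tangentMapWithin]
  rw [mfderivWithin_of_isOpen e.open_source (e.map_target hy)]
  rfl

/-- A kernel vector `c` of the Gram matrix gives the tangent vector `c^ν ∂_ν`, orthogonal to every
`∂_μ` and so to the whole tangent space. Non-degeneracy makes it zero, and injectivity of the
differential of `e.symm` gives `c = 0`. -/
lemma IsCoord.isUnit_det_gMat (he : IsCoord e) (g : PseudoRiemannianMetric n M) {y : Rn n}
    (hy : y ∈ e.target) : IsUnit (gMat g e y).det := by
  rw [isUnit_iff_ne_zero]
  intro h0
  obtain ⟨c, hc0, hc⟩ := Matrix.exists_mulVec_eq_zero_iff.2 h0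
  let L : Rn n →L[ℝ] TangentSpace (𝓡 n) (e.symm y) := mfderiv 𝓘(ℝ, Rn n) (𝓡 n) e.symm y
  have hbij : Function.Bijective L := he.mdifferentiable.symm.mfderiv_bijective hy
  have hexp : ∀ w : Rn n, L w = ∑ μ, w μ • coordVec e μ y := by
    intro w
    have : w = ∑ μ, w μ • EuclideanSpace.single μ (1 : ℝ) := by
      ext i
      simp [Pi.single_apply]
    conv_lhs => rw [this]
    rw [map_sum]
    exact Finset.sum_congr rfl fun μ _ => map_smul L _ _
  have hμ : ∀ μ, g.val (e.symm y) (coordVec e μ y) (L (WithLp.toLp 2 c)) = 0 := by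
    intro μ
    rw [hexp, map_sum]
    refine Eq.trans (Finset.sum_congr rfl fun ν _ => ?_) (congrFun hc μ)
    rw [map_smul, smul_eq_mul, mul_comm]
    rfl
  have hL : L (WithLp.toLp 2 c) = 0 := by
    refine g.nondegenerate _ _ fun w => ?_
    obtain ⟨w, rfl⟩ := hbij.2 w
    rw [g.symm, hexp w, map_sum, sum_apply]
    refine Finset.sum_eq_zero fun μ _ => ?_
    rw [map_smul, smul_apply, hμ, smul_zero]
  have := hbij.1 (hL.trans (map_zero L).symm)
  exact hc0 (funext fun i => congrArg (fun v : Rn n => v i) this)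

lemma IsCoord.isMetricOn_gMat (he : IsCoord e) (g : PseudoRiemannianMetric n M) :
    Coord.IsMetricOn (gMat g e) e.target where
  isOpen := e.open_target
  contDiffOn := he.contDiffOn_gMat g
  symm _ _ _ := g.symm _ _ _
  isUnit_det := he.isUnit_det_gMat g

lemma IsCoord.contDiffAt_comp (he : IsCoord e) {γ : ℝ → M} {J : Set ℝ} (hJ : IsOpen J)
    (hγ : ContMDiffOn 𝓘(ℝ, ℝ) (𝓡 n) 2 γ J) {t : ℝ} (ht : t ∈ J) (hte : γ t ∈ e.source) :
    ContDiffAt ℝ 2 (fun s => e (γ s)) t := by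
  have h1 : ContMDiffAt 𝓘(ℝ, ℝ) (𝓡 n) 2 γ t := hγ.contMDiffAt (hJ.mem_nhds ht)
  have h2 : ContMDiffAt (𝓡 n) 𝓘(ℝ, Rn n) 2 e (γ t) :=
    (he.contMDiffOn.contMDiffAt (e.open_source.mem_nhds hte)).of_le
      Coord.two_le_infty
  exact (h2.comp t h1).contDiffAt

end Manifold

end

theorem mainTheorem3 {n : ℕ} {M : Type*} [TopologicalSpace M] [ChartedSpace (Rn n) M]
    [IsManifold (𝓡 n) ∞ M] (g : PseudoRiemannianMetric n M)
    (ξ : (x : M) → TangentSpace (𝓡 n) x) (hξ : IsHomotheticKilling g ξ)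
    (J : Set ℝ) (hJ : IsOpen J) (γ : ℝ → M) (hγ : IsGeodesicOn g γ J)
    (e : OpenPartialHomeomorph M (Rn n)) (he : IsCoord e)
    (t : ℝ) (ht : t ∈ J) (hte : γ t ∈ e.source) (ρ : Fin n) :
    -- `p^μ p^ν ∇_μ ∇_ν ξ_ρ = - R_{ρμσν} p^μ p^ν ξ^σ`
    (∑ μ, ∑ ν, Coord.vel (fun s => e (γ s)) μ t * Coord.vel (fun s => e (γ s)) ν t *
        Coord.nabla2 (gMat g e) (vecDown g ξ e) μ ν ρ (e (γ t))
      = -∑ μ, ∑ σ, ∑ ν, Coord.riem (gMat g e) ρ μ σ ν (e (γ t)) *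
          Coord.vel (fun s => e (γ s)) μ t * Coord.vel (fun s => e (γ s)) ν t *
          vecUp ξ e σ (e (γ t))) ∧
    -- `D²ξ_ρ/dt² = - R_{ρμσν} p^μ p^ν ξ^σ` for the field `ξ` along the geodesic
    (Coord.DCov (gMat g e) (fun s => e (γ s))
        (Coord.DCov (gMat g e) (fun s => e (γ s)) fun κ s => vecDown g ξ e κ (e (γ s))) ρ t
      = -∑ μ, ∑ σ, ∑ ν, Coord.riem (gMat g e) ρ μ σ ν (e (γ t)) *
          Coord.vel (fun s => e (γ s)) μ t * Coord.vel (fun s => e (γ s)) ν t *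
          vecUp ξ e σ (e (γ t))) := by
  obtain ⟨hξs, lam, hK⟩ := hξ
  have hG := he.isMetricOn_gMat g
  have hv := he.contDiffOn_vecUp hξs
  have hα : ∀ i, ContDiffOn ℝ ∞ (vecDown g ξ e i) e.target :=
    fun i => ContDiffOn.sum fun j _ => (hG.contDiffOn i j).mul (hv j)
  have h1 := hG.sum_nabla2 (e.map_source hte) hv (hK e he)
    (fun μ => Coord.vel (fun s => e (γ s)) μ t) ρ
  refine ⟨h1, Eq.trans ?_ h1⟩
  exact hG.DCov_DCov hα (he.contDiffAt_comp hJ hγ.1 ht hte) (e.map_source hte)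
    (hγ.2 e he t ht hte) ρ
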